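/- Let $a,b:[0,\infty)\to\mathbb R$ be Lebesgue measurable and essentially bounded with $a(t)\ge b(t)\ge 0$, and let $h,g:[0,\infty)\to\mathbb R$ be Lebesgue measurable with $0\le t-h(t)\le\tau$ and $0\le t-g(t)\le\delta$ for some finite constants $\tau,\delta$. Put $r=\max\{\delta,\tau\}$ and consider $$\dot x(t)+a(t)x(h(t))-b(t)x(g(t))=0. \qquad (1)$$ For $s_0\ge 0$ and a bounded Borel measurable $\varphi:[s_0-r,s_0]\to\mathbb R$, the solution of (1) with initial data $(s_0,\varphi)$ is the function $x$ that is locally absolutely continuous on $[s_0,\infty)$, satisfies (1) for almost every $t\ge s_0$, and equals $\varphi$ on $[s_0-r,s_0]$; write $|\varphi|_\infty=\sup_{[s_0-r,s_0]}|\varphi|$. Equation (1) is asymptotically stable if for every $s_0\ge0$: for every $\varepsilon>0$ there is $\eta>0$ such that $|\varphi|_\infty<\eta$ implies $|x(t)|<\varepsilon$ for all $t\ge s_0$; and $\lim_{t\to\infty}x(t)=0$ for every $\varphi$. It is uniformly exponentially stable if there are $M,\gamma>0$, independent of $s_0\ge 0$ and $\varphi$, with $|x(t)|\le Me^{-\gamma(t-s_0)}|\varphi|_\infty$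 for all $t\ge s_0$. For $t_0\ge0$ write $\|f\|_{[t_0,\infty)}=\operatorname{ess\,sup}_{t\ge t_0}|f(t)|$ and $u^+=\max\{u,0\}$; in integrals with a negative endpoint, $a$ is extended by $0$ to $(-\infty,0)$. Theorem 3. Assume that $a(t)\ne0$ a.e., $\int_0^\infty a(s)\,ds=\infty$, and that for some $t_0\ge 0$ $$\operatorname*{ess\,sup}_{t\ge t_0}\frac{b(t)}{a(t)}<1,\qquad \operatorname*{ess\,sup}_{t\ge t_0}\left|\int_{h(t)}^{g(t)}a(s)\,ds\right|<1,$$ $$\left\|\left(\int_{h(\cdot)}^{\,\cdot}a(s)\,ds-\frac1e\right)^{+}\right\|_{[t_0,\infty)}<\frac{1-\left\|\frac ba\right\|_{[t_0,\infty)}}{\left\|1-\frac ba\right\|_{[t_0,\infty)}}\left(1-\left\|\int_{h(\cdot)}^{g(\cdot)}a(s)\,ds\right\|_{[t_0,\infty)}\right).$$ Then equation (1) is asymptotically stable. If in addition there exists $T>0$ such that $\liminf_{t\to\infty}\int_t^{t+T}a(s)\,ds>0$, then equation (1) is uniformly exponentially stable. -/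

import Mathlib

open Set Filter MeasureTheory

namespace DelayEq

/-- The standing conditions on the data of the equation
`x'(t) + a(t) x(h(t)) - b(t) x(g(t)) = 0`: the coefficients are Lebesgue measurable and essentially
bounded on `[0,∞)` (this is `MemLp · ⊤`) with `a ≥ b ≥ 0`, and the delayed arguments are Lebesgue
measurable on `[0,∞)` with delays in `[0,τ]` and `[0,δ]` respectively. Only the values of the four
functions on `[0,∞)` matter. -/
structure Data (a b h g : ℝ → ℝ) (τ δ : ℝ) : Prop where
  memLp_a : MemLp a ⊤ (volume.restrict (Ici (0 : ℝ)))
  memLp_b : MemLp b ⊤ (volume.restrict (Ici (0 : ℝ)))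
  b_nonneg : ∀ t, 0 ≤ t → 0 ≤ b t
  b_le_a : ∀ t, 0 ≤ t → b t ≤ a t
  aemeasurable_h : AEMeasurable h (volume.restrict (Ici (0 : ℝ)))
  aemeasurable_g : AEMeasurable g (volume.restrict (Ici (0 : ℝ)))
  h_delay : ∀ t, 0 ≤ t → 0 ≤ t - h t ∧ t - h t ≤ τ
  g_delay : ∀ t, 0 ≤ t → 0 ≤ t - g t ∧ t - g t ≤ δ

/-- `φ` is Borel measurable and bounded on `[t₀ - r, t₀]` (its other values are irrelevant). -/
def IsInitialFunction (r t₀ : ℝ) (φ : ℝ → ℝ) : Prop :=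
  Measurable (fun t : Icc (t₀ - r) t₀ => φ t) ∧ ∃ C : ℝ, ∀ t ∈ Icc (t₀ - r) t₀, |φ t| ≤ C

/-- `sup |φ|` over `[t₀ - r, t₀]`. -/
noncomputable def initialSup (r t₀ : ℝ) (φ : ℝ → ℝ) : ℝ :=
  sSup ((fun t => |φ t|) '' Icc (t₀ - r) t₀)

/-- `x` solves `x'(t) + a(t) x(h(t)) - b(t) x(g(t)) = 0` for `t ≥ t₀`, `x = φ` on `[t₀ - r, t₀]`:
it is locally absolutely continuous on `[t₀,∞)`, satisfies the equation almost everywhere on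
`[t₀,∞)` and the initial condition on `[t₀ - r, t₀]`. -/
structure IsSolution (a b h g : ℝ → ℝ) (r t₀ : ℝ) (φ x : ℝ → ℝ) : Prop where
  absCont : ∀ t₁, t₀ ≤ t₁ → AbsolutelyContinuousOnInterval x t₀ t₁
  equation : ∀ᵐ t ∂(volume.restrict (Ici t₀)),
    DifferentiableAt ℝ x t ∧ deriv x t + a t * x (h t) - b t * x (g t) = 0
  initial : ∀ t ∈ Icc (t₀ - r) t₀, x t = φ t

/-- Asymptotic stability: for every initial point `t₀ ≥ 0` the zero solution is stable, and every
solution tends to zero. -/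
def AsymptoticallyStable (a b h g : ℝ → ℝ) (r : ℝ) : Prop :=
  ∀ t₀, 0 ≤ t₀ →
    (∀ ε, 0 < ε → ∃ η, 0 < η ∧ ∀ φ x, IsInitialFunction r t₀ φ → IsSolution a b h g r t₀ φ x →
      initialSup r t₀ φ < η → ∀ t, t₀ ≤ t → |x t| < ε) ∧
    (∀ φ x, IsInitialFunction r t₀ φ → IsSolution a b h g r t₀ φ x →
      Tendsto x atTop (nhds 0))

/-- Uniform exponential stability: one pair of constants `M`, `γ` serves all initial points
`t₀ ≥ 0` and all initial functions. -/
def UniformlyExponentiallyStable (a b h g : ℝ → ℝ) (r : ℝ) : Prop :=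
  ∃ M γ, 0 < M ∧ 0 < γ ∧
    ∀ t₀, 0 ≤ t₀ → ∀ φ x, IsInitialFunction r t₀ φ → IsSolution a b h g r t₀ φ x →
      ∀ t, t₀ ≤ t → |x t| ≤ M * Real.exp (-γ * (t - t₀)) * initialSup r t₀ φ

/-- The essential supremum of `f` over `[t₀,∞)`. -/
noncomputable def esssupFrom (t₀ : ℝ) (f : ℝ → ℝ) : ℝ :=
  essSup f (volume.restrict (Ici t₀))

/-- The norm `‖f‖_{[t₀,∞)}`, the essential supremum of `|f|` over `[t₀,∞)`. -/
noncomputable def normFrom (t₀ : ℝ) (f : ℝ → ℝ) : ℝ :=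
  esssupFrom t₀ (fun t => |f t|)

/-- The oriented integral `∫_u^v a(s) ds` of a coefficient given on `[0,∞)`; as `u` or `v` may be
negative when the delayed argument is, the coefficient is extended by zero to `(-∞,0)`. -/
noncomputable def coeffIntegral (a : ℝ → ℝ) (u v : ℝ) : ℝ :=
  ∫ s in u..v, (Ici (0 : ℝ)).indicator a s

end DelayEq

/-!
Let `p` be the primitive of `a`, used as a clock in which the leading coefficient becomes `1`. Write
`β = ‖b/a‖`, `ν = ‖1 - b/a‖`, `κ = ‖∫_h^g a‖` and `A = ‖(∫_h^t a - 1/e)⁺‖`. The hypothesis of the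
theorem says that `β + A ν / (1 - κ) < 1`, which is the contraction constant of an a priori
estimate for solutions.

The estimate comes from shortening the leading delay. Let `u(t)` be the point between `h t` and `t`
whose clock lag is that of `h t` cut off at `1/e`. Then `x' + a x(u) = a f` with
`f = (b/a) x(g) + (x(u) - x(h))`. Three facts bound `x` in terms of itself.

* When the clock lag is at most `1/e`, the equation `x' + a x(u) = 0` has the positivity property
  (`IsClock.nonneg_of_delay_inequality`), and comparison with constants gives `‖x‖ ≤ ‖f‖` up to
  twice the size of the history (`IsClock.abs_le_of_forced`).
* The clock distance of `h t` and `u t` is at most `A`, so `|x(u) - x(h)|` is at most `A` times the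
  slope of `x` with respect to the clock.
* Since `x' = -(a - b) x(h) + b (x(g) - x(h))`, that slope is at most `ν ‖x‖` plus `κ` times itself,
  hence at most `ν ‖x‖ / (1 - κ)` (`ClockBounds.abs_sub_le`).

The inequality is strict, so it survives for `exp(lam p) x` with a small `lam > 0`
(`ClockBounds.abs_le_of_isWeightedSolution`); together with a Gronwall bound on the initial
stretch (`IsClock.abs_le_exp`) this gives `|x t| ≤ M exp(-lam (p t - p s₀)) ‖φ‖` with constants
independent of the initial data (`ClockBounds.exists_exp_decay`). Divergence of `∫ a` turns this
into asymptotic stability, and at least linear growth of `p` into uniform exponential stability.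

All self-improving bounds are closed by one principle, `fixedPoint_mem_of_contraction`. Derivatives
enter only through pointwise almost everywhere inequalities between absolutely continuous functions,
so the measurability of `x ∘ h` and `x ∘ g` plays no role.
-/

namespace DelayEq

/-! ### Absolutely continuous functions with almost everywhere comparable derivatives -/

/-- Two absolutely continuous functions whose derivatives are ordered almost everywhere have
increments ordered in the same way. -/
theorem sub_le_sub_of_ae_hasDerivAt_le {f w : ℝ → ℝ} {s T : ℝ} (hsT : s ≤ T)
    (hf : AbsolutelyContinuousOnInterval f s T) (hw : AbsolutelyContinuousOnInterval w s T)
    (h : ∀ᵐ t, t ∈ Icc s T → ∃ d e, HasDerivAt f d t ∧ HasDerivAt w e t ∧ d ≤ e) :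
    f T - f s ≤ w T - w s := by
  rw [← hf.integral_deriv_eq_sub, ← hw.integral_deriv_eq_sub]
  refine intervalIntegral.integral_mono_ae_restrict hsT hf.intervalIntegrable_deriv
    hw.intervalIntegrable_deriv ?_
  rw [Filter.EventuallyLE, ae_restrict_iff' measurableSet_Icc]
  filter_upwards [h] with t ht hmem
  obtain ⟨d, e, hd, he, hde⟩ := ht hmem
  rwa [hd.deriv, he.deriv]

theorem abs_sub_le_of_ae_hasDerivAt_le {f w : ℝ → ℝ} {s T : ℝ} (hsT : s ≤ T)
    (hf : AbsolutelyContinuousOnInterval f s T) (hw : AbsolutelyContinuousOnInterval w s T)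
    (h : ∀ᵐ t, t ∈ Icc s T → ∃ d e, HasDerivAt f d t ∧ HasDerivAt w e t ∧ |d| ≤ e) :
    |f T - f s| ≤ w T - w s := by
  have h1 := sub_le_sub_of_ae_hasDerivAt_le hsT hf hw <| by
    filter_upwards [h] with t ht hmem
    obtain ⟨d, e, hd, he, hle⟩ := ht hmem
    exact ⟨d, e, hd, he, (abs_le.1 hle).2⟩
  have h2 := sub_le_sub_of_ae_hasDerivAt_le hsT hf.fun_neg hw <| by
    filter_upwards [h] with t ht hmem
    obtain ⟨d, e, hd, he, hle⟩ := ht hmem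
    exact ⟨-d, e, hd.fun_neg, he, by linarith [(abs_le.1 hle).1]⟩
  rw [abs_le]
  constructor <;> linarith

theorem absolutelyContinuousOnInterval_mono {f : ℝ → ℝ} {s T u v : ℝ}
    (hf : AbsolutelyContinuousOnInterval f s T) (hu : s ≤ u) (huv : u ≤ v) (hv : v ≤ T) :
    AbsolutelyContinuousOnInterval f u v := by
  refine hf.mono ?_
  rw [uIcc_of_le huv, uIcc_of_le (hu.trans (huv.trans hv))]
  exact Icc_subset_Icc hu hv

/-- The improvement principle for bounds: if a closed set of admissible bounds is stable under
an affine contraction, then it contains the fixed point of that contraction. -/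
theorem fixedPoint_mem_of_contraction {S : Set ℝ} (hS : IsClosed S) {q c D₀ : ℝ} (hq : 0 ≤ q)
    (hq1 : q < 1) (h₀ : D₀ ∈ S) (hstep : ∀ D ∈ S, q * D + c ∈ S) : c / (1 - q) ∈ S := by
  have hne : 1 - q ≠ 0 := by linarith
  have hmem : ∀ n : ℕ, c / (1 - q) + q ^ n * (D₀ - c / (1 - q)) ∈ S := by
    intro n
    induction n with
    | zero => simpa using h₀
    | succ n ih =>
      convert hstep _ ih using 1
      rw [pow_succ]
      field_simp
      ring
  refine hS.mem_of_tendsto (f := fun n : ℕ => c / (1 - q) + q ^ n * (D₀ - c / (1 - q)))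
    (b := atTop) ?_ (Eventually.of_forall hmem)
  have := ((tendsto_pow_atTop_nhds_zero_of_lt_one hq hq1).mul_const
    (D₀ - c / (1 - q))).const_add (c / (1 - q))
  simpa using this

/-! ### The intrinsic clock of the equation -/

/-- `p` is a primitive of the coefficient `a`: a nondecreasing Lipschitz function on the line with
derivative `a` almost everywhere on `[0,∞)`. It serves as the clock in which the equation has
leading coefficient `1`. -/
structure IsClock (a p : ℝ → ℝ) : Prop where
  mono : Monotone p
  lipschitz : ∃ α, LipschitzWith α p
  hasDerivAt : ∀ᵐ t, 0 ≤ t → HasDerivAt p (a t) t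
  nonneg : ∀ t, 0 ≤ t → 0 ≤ a t

theorem IsClock.continuous {a p : ℝ → ℝ} (hp : IsClock a p) : Continuous p :=
  hp.lipschitz.choose_spec.continuous

theorem IsClock.absolutelyContinuous {a p : ℝ → ℝ} (hp : IsClock a p) (s T : ℝ) :
    AbsolutelyContinuousOnInterval p s T :=
  hp.lipschitz.choose_spec.lipschitzOnWith.absolutelyContinuousOnInterval

theorem IsClock.absolutelyContinuous_exp {a p : ℝ → ℝ} (hp : IsClock a p) (c s T : ℝ) :
    AbsolutelyContinuousOnInterval (fun t => Real.exp (c * p t)) s T := by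
  have hexp : LocallyLipschitz (fun x : ℝ => Real.exp (c * x)) :=
    ContDiff.locallyLipschitz (𝕂 := ℝ) (by fun_prop)
  have h : LocallyLipschitz (fun t => Real.exp (c * p t)) :=
    hexp.comp hp.lipschitz.choose_spec.locallyLipschitz
  obtain ⟨K, hK⟩ := h.locallyLipschitzOn.exists_lipschitzOnWith_of_compact
    (isCompact_uIcc (a := s) (b := T))
  exact hK.absolutelyContinuousOnInterval

theorem hasDerivAt_exp_clock {p : ℝ → ℝ} {c d t : ℝ} (h : HasDerivAt p d t) :
    HasDerivAt (fun t => Real.exp (c * p t)) (c * d * Real.exp (c * p t)) t := by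
  convert (h.const_mul c).exp using 1
  ring

/-- A function whose derivative is bounded by `C a` almost everywhere is `C`-Lipschitz with respect
to the clock. -/
theorem IsClock.abs_sub_le {a p : ℝ → ℝ} (hp : IsClock a p) {y : ℝ → ℝ} {s T C : ℝ} (hs : 0 ≤ s)
    (hy : AbsolutelyContinuousOnInterval y s T)
    (h : ∀ᵐ t, t ∈ Icc s T → ∃ d, HasDerivAt y d t ∧ |d| ≤ C * a t)
    {u v : ℝ} (hu : s ≤ u) (huv : u ≤ v) (hv : v ≤ T) :
    |y v - y u| ≤ C * (p v - p u) := by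
  rw [mul_sub]
  refine abs_sub_le_of_ae_hasDerivAt_le huv (absolutelyContinuousOnInterval_mono hy hu huv hv)
    ((hp.absolutelyContinuous u v).const_mul C) ?_
  filter_upwards [h, hp.hasDerivAt] with t ht hpt hmem
  obtain ⟨d, hd, hle⟩ := ht ⟨hu.trans hmem.1, hmem.2.trans hv⟩
  exact ⟨d, _, hd, (hpt (by linarith [hmem.1])).const_mul C, hle⟩

/-! ### Positivity for delays of clock length at most `1/e` -/

/-- The classical positivity criterion in clock time: if `z' + a z(u(t)) ≥ 0`, where `u(t)` lags
behind `t` by at most `1/e` on the clock, then `z` stays nonnegative. The reason is that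
`v = exp(e p) z` satisfies `v' ≥ e a (v - v(u)⁺)`, so that it is nondecreasing: any bound
`v t₁ - v t₂ ≤ D exp(2 e p t₂)` on its decrease improves itself to one with `D / 2`. -/
theorem IsClock.nonneg_of_delay_inequality {a p : ℝ → ℝ} (hp : IsClock a p) {z : ℝ → ℝ} {s T : ℝ}
    (hs : 0 ≤ s) (hz : AbsolutelyContinuousOnInterval z s T) (hzs : 0 ≤ z s)
    (h : ∀ᵐ t, t ∈ Icc s T → ∃ d u, HasDerivAt z d t ∧ u ∈ Icc s t ∧
      p t - p u ≤ 1 / Real.exp 1 ∧ -(a t * z u) ≤ d)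
    {t : ℝ} (ht : t ∈ Icc s T) : 0 ≤ z t := by
  have hsT : s ≤ T := ht.1.trans ht.2
  set E := Real.exp 1 with hE
  have hE0 : 0 < E := Real.exp_pos 1
  set v : ℝ → ℝ := fun t => Real.exp (E * p t) * z t with hv
  have hvAC : AbsolutelyContinuousOnInterval v s T := (hp.absolutelyContinuous_exp E s T).mul hz
  have hvs : 0 ≤ v s := by positivity
  set S : Set ℝ := {D | 0 ≤ D ∧ ∀ t₁ t₂, s ≤ t₁ → t₁ ≤ t₂ → t₂ ≤ T →
    v t₁ - v t₂ ≤ D * Real.exp (2 * E * p t₂)} with hS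
  have hclosed : IsClosed S := by
    simp only [hS, ofPred_and, ofPred_forall]
    refine (isClosed_le continuous_const continuous_id).inter ?_
    refine isClosed_iInter fun _ => isClosed_iInter fun _ => isClosed_iInter fun _ =>
      isClosed_iInter fun _ => isClosed_iInter fun _ => isClosed_le (by fun_prop) (by fun_prop)
  obtain ⟨C, hC⟩ := hvAC.exists_bound
  rw [uIcc_of_le hsT] at hC
  have hC0 : 0 ≤ C := (norm_nonneg _).trans (hC s ⟨le_rfl, hsT⟩)
  have h₀ : 2 * C * Real.exp (-(2 * E * p s)) ∈ S := by
    refine ⟨by positivity, fun t₁ t₂ h1 h12 h2 => ?_⟩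
    have e1 := (abs_le.1 (hC t₁ ⟨h1, h12.trans h2⟩)).2
    have e2 := (abs_le.1 (hC t₂ ⟨h1.trans h12, h2⟩)).1
    rw [mul_assoc, ← Real.exp_add]
    have : 1 ≤ Real.exp (-(2 * E * p s) + 2 * E * p t₂) := by
      rw [Real.one_le_exp_iff]
      nlinarith [hp.mono (h1.trans h12)]
    nlinarith
  have hstep : ∀ D ∈ S, 1 / 2 * D + 0 ∈ S := by
    rintro D ⟨hD0, hD⟩
    refine ⟨by positivity, fun t₁ t₂ h1 h12 h2 => ?_⟩
    have hcmp := sub_le_sub_of_ae_hasDerivAt_le h12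
      (absolutelyContinuousOnInterval_mono hvAC h1 h12 h2).fun_neg
      ((hp.absolutelyContinuous_exp (2 * E) t₁ t₂).const_mul (D / 2)) <| by
      filter_upwards [h, hp.hasDerivAt] with t ht hpt hmem
      obtain ⟨d, u, hd, hu, hpu, hle⟩ := ht ⟨h1.trans hmem.1, hmem.2.trans h2⟩
      have ht0 : 0 ≤ t := by linarith [hmem.1]
      have ha := hp.nonneg t ht0
      refine ⟨_, _, ((hasDerivAt_exp_clock (c := E) (hpt ht0)).mul hd).fun_neg,
        (hasDerivAt_exp_clock (c := 2 * E) (hpt ht0)).const_mul (D / 2), ?_⟩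
      have b1 : v u ≤ v t + D * Real.exp (2 * E * p t) := by
        linarith [hD u t hu.1 hu.2 (hmem.2.trans h2)]
      have b2 : 0 ≤ v t + D * Real.exp (2 * E * p t) := by
        linarith [hD s t le_rfl (h1.trans hmem.1) (hmem.2.trans h2)]
      -- the delayed term costs at most the factor `exp(e (p t - p u)) ≤ e`
      have b3 : Real.exp (E * p t) * z u ≤ E * (v t + D * Real.exp (2 * E * p t)) := by
        have : Real.exp (E * p t) * z u = Real.exp (E * (p t - p u)) * v u := by
          rw [hv, ← mul_assoc, ← Real.exp_add]
          ring_nf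
        rw [this]
        have hfac : Real.exp (E * (p t - p u)) ≤ E := by
          rw [hE]
          apply Real.exp_le_exp.2
          rw [← hE]
          calc E * (p t - p u) ≤ E * (1 / E) := by gcongr
            _ = 1 := by field_simp
        calc Real.exp (E * (p t - p u)) * v u
            ≤ Real.exp (E * (p t - p u)) * (v t + D * Real.exp (2 * E * p t)) := by gcongr
          _ ≤ _ := by gcongr
      have b4 : -(Real.exp (E * p t) * d) ≤ a t * (Real.exp (E * p t) * z u) := by
        nlinarith [Real.exp_pos (E * p t)]
      have b5 := mul_le_mul_of_nonneg_left b3 ha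
      simp only [hv] at b5
      linarith
    have hpos := Real.exp_pos (2 * E * p t₁)
    nlinarith
  have h0 := (fixedPoint_mem_of_contraction hclosed (by norm_num) (by norm_num) h₀ hstep).2 s t
    le_rfl ht.1 ht.2
  have hvt : 0 ≤ v t := by
    simp at h0
    linarith
  exact nonneg_of_mul_nonneg_right hvt (Real.exp_pos _)

/-- One-sided half of `IsClock.abs_le_of_forced`. -/
theorem IsClock.le_of_forced {a p : ℝ → ℝ} (hp : IsClock a p) {y : ℝ → ℝ} {s T F K : ℝ}
    (hs : 0 ≤ s) (hF : 0 ≤ F) (hy : AbsolutelyContinuousOnInterval y s T) (hys : |y s| ≤ K)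
    (h : ∀ᵐ t, t ∈ Icc s T → ∃ d u, HasDerivAt y d t ∧ |d + a t * y u| ≤ a t * F ∧ u ≤ t ∧
      p t - p u ≤ 1 / Real.exp 1 ∧ (u < s → |y u| ≤ K))
    {t : ℝ} (ht : t ∈ Icc s T) : y t ≤ F + 2 * K := by
  have hAC : AbsolutelyContinuousOnInterval (fun t => F + 2 * K + -y t) s T :=
    (LipschitzWith.const (F + 2 * K)).lipschitzOnWith.absolutelyContinuousOnInterval.fun_add
      hy.fun_neg
  have := hp.nonneg_of_delay_inequality hs hAC
    (by linarith [(abs_le.1 hys).2, (abs_nonneg (y s)).trans hys]) ?_ ht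
  · linarith
  filter_upwards [h] with t ht hmem
  obtain ⟨d, u, hd, hle, hut, hpu, hK⟩ := ht hmem
  have ha := hp.nonneg t (hs.trans hmem.1)
  have hle' := (abs_le.1 hle).2
  have hK0 : 0 ≤ K := (abs_nonneg _).trans hys
  rcases lt_or_ge u s with hus | hus
  · -- delayed values taken from the history are dominated by the value at `s`
    refine ⟨-d, s, hd.fun_neg.const_add _, ⟨le_rfl, hmem.1⟩,
      by linarith [hp.mono hus.le], ?_⟩
    have h1 := (abs_le.1 (hK hus)).1
    have h2 := (abs_le.1 hys).2
    nlinarith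
  · exact ⟨-d, u, hd.fun_neg.const_add _, ⟨hus, hut⟩, hpu, by nlinarith⟩

/-- A sharp bound for the forced equation `y' + a y(u(t)) = a f` with `|f| ≤ F`, whose delay has
clock length at most `1/e`: the forcing enters with constant `1`, since constants are
supersolutions, and the history, bounded by `K`, contributes at most `2 K`. -/
theorem IsClock.abs_le_of_forced {a p : ℝ → ℝ} (hp : IsClock a p) {y : ℝ → ℝ} {s T F K : ℝ}
    (hs : 0 ≤ s) (hF : 0 ≤ F) (hy : AbsolutelyContinuousOnInterval y s T) (hys : |y s| ≤ K)
    (h : ∀ᵐ t, t ∈ Icc s T → ∃ d u, HasDerivAt y d t ∧ |d + a t * y u| ≤ a t * F ∧ u ≤ t ∧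
      p t - p u ≤ 1 / Real.exp 1 ∧ (u < s → |y u| ≤ K))
    {t : ℝ} (ht : t ∈ Icc s T) : |y t| ≤ F + 2 * K := by
  rw [abs_le]
  refine ⟨?_, hp.le_of_forced hs hF hy hys h ht⟩
  have := hp.le_of_forced (y := fun t => -y t) hs hF hy.fun_neg (by simpa using hys) ?_ ht
  · linarith
  filter_upwards [h] with t ht hmem
  obtain ⟨d, u, hd, hle, hut, hpu, hK⟩ := ht hmem
  refine ⟨-d, u, hd.fun_neg, ?_, hut, hpu, by simpa using hK⟩
  rwa [← abs_neg, show -(-d + a t * -y u) = d + a t * y u by ring]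

/-! ### A priori estimates for the equation -/

/-- The rough growth bound for solutions, a Gronwall estimate on the clock. -/
theorem IsClock.abs_le_exp {a p : ℝ → ℝ} (hp : IsClock a p) {h g x : ℝ → ℝ} {r s T K : ℝ}
    (hs : 0 ≤ s) (hh : ∀ t, 0 ≤ t → t - r ≤ h t ∧ h t ≤ t)
    (hg : ∀ t, 0 ≤ t → t - r ≤ g t ∧ g t ≤ t)
    (hx : AbsolutelyContinuousOnInterval x s T) (hr : 0 ≤ r) (hK : ∀ t ∈ Icc (s - r) s, |x t| ≤ K)
    (hder : ∀ᵐ t, t ∈ Icc s T → ∃ d, HasDerivAt x d t ∧ |d| ≤ a t * (|x (h t)| + |x (g t)|))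
    {t : ℝ} (ht : t ∈ Icc s T) : |x t| ≤ 2 * K * Real.exp (4 * (p t - p s)) := by
  have hsT : s ≤ T := ht.1.trans ht.2
  have hK0 : 0 ≤ K := (abs_nonneg _).trans (hK s ⟨by linarith, le_rfl⟩)
  set w : ℝ → ℝ := fun t => Real.exp (-(4 * p s)) * Real.exp (4 * p t) with hw
  have hws : w s = 1 := by simp [hw, ← Real.exp_add]
  have hw1 : ∀ t, s ≤ t → 1 ≤ w t := fun t ht => by
    simp only [hw, ← Real.exp_add, Real.one_le_exp_iff]
    linarith [hp.mono ht]
  have hw_mono : Monotone w := fun u v huv => by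
    simp only [hw]
    gcongr
    exact hp.mono huv
  set S : Set ℝ := {D | 0 ≤ D ∧ ∀ t, t ∈ Icc s T → |x t| ≤ D * w t} with hS
  have hclosed : IsClosed S := by
    simp only [hS, ofPred_and, ofPred_forall]
    refine (isClosed_le continuous_const continuous_id).inter ?_
    exact isClosed_iInter fun _ => isClosed_iInter fun _ => isClosed_le (by fun_prop) (by fun_prop)
  obtain ⟨C, hC⟩ := hx.exists_bound
  rw [uIcc_of_le hsT] at hC
  have hC0 : 0 ≤ C := (norm_nonneg _).trans (hC s ⟨le_rfl, hsT⟩)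
  have h₀ : C ∈ S := ⟨hC0, fun t ht => (hC t ht).trans (by nlinarith [hw1 t ht.1])⟩
  have hstep : ∀ D ∈ S, 1 / 2 * D + K ∈ S := by
    rintro D ⟨hD0, hD⟩
    refine ⟨by positivity, fun t ht => ?_⟩
    have hdelay : ∀ v u, s ≤ v → v ≤ T → v - r ≤ u → u ≤ v → |x u| ≤ (K + D) * w v := by
      intro v u hsv hvT hu huv
      rcases le_total u s with hus | hus
      · have := hK u ⟨by linarith, hus⟩
        nlinarith [hw1 v hsv]
      · have := hD u ⟨hus, huv.trans hvT⟩
        nlinarith [hw_mono huv, hw1 v hsv]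
    have hcmp := abs_sub_le_of_ae_hasDerivAt_le ht.1
      (absolutelyContinuousOnInterval_mono hx le_rfl ht.1 ht.2)
      (((hp.absolutelyContinuous_exp 4 s t).const_mul
        (Real.exp (-(4 * p s)))).const_mul ((K + D) / 2)) <| by
      filter_upwards [hder, hp.hasDerivAt] with v hv hpv hmem
      obtain ⟨d, hd, hle⟩ := hv ⟨hmem.1, hmem.2.trans ht.2⟩
      have hv0 : 0 ≤ v := hs.trans hmem.1
      refine ⟨d, _, hd, ((hasDerivAt_exp_clock (c := 4) (hpv hv0)).const_mul _).const_mul _,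
        hle.trans ?_⟩
      have e1 := hdelay v (h v) hmem.1 (hmem.2.trans ht.2) (hh v hv0).1 (hh v hv0).2
      have e2 := hdelay v (g v) hmem.1 (hmem.2.trans ht.2) (hg v hv0).1 (hg v hv0).2
      have := mul_le_mul_of_nonneg_left (add_le_add e1 e2) (hp.nonneg v hv0)
      refine this.trans (le_of_eq ?_)
      simp only [hw]
      ring
    change _ ≤ (K + D) / 2 * w t - (K + D) / 2 * w s at hcmp
    have h1 := hK s ⟨by linarith, le_rfl⟩
    have h2 : |x t| ≤ |x t - x s| + |x s| := by simpa using abs_add_le (x t - x s) (x s)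
    rw [hws] at hcmp
    nlinarith [hw1 t ht.1]
  have h0 := (fixedPoint_mem_of_contraction hclosed (by norm_num) (by norm_num) h₀ hstep).2 t ht
  have hwt : w t = Real.exp (4 * (p t - p s)) := by
    simp only [hw, ← Real.exp_add]
    ring_nf
  rw [← hwt]
  refine h0.trans (le_of_eq ?_)
  ring

/-- The quantitative assumptions on the equation in terms of the clock `p`: `β` and `ν` bound `b/a`
and `1 - b/a`, `κ` bounds the clock distance of the two delayed arguments, and `A` is the excess of
the clock length of the delay of the leading term over `1/e`. -/
structure ClockBounds (a b h g p : ℝ → ℝ) (r t₀ β ν κ A : ℝ) : Prop where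
  isClock : IsClock a p
  r_nonneg : 0 ≤ r
  t₀_nonneg : 0 ≤ t₀
  delay_h : ∀ t, 0 ≤ t → t - r ≤ h t ∧ h t ≤ t
  delay_g : ∀ t, 0 ≤ t → t - r ≤ g t ∧ g t ≤ t
  b_nonneg : ∀ t, 0 ≤ t → 0 ≤ b t
  b_le_a : ∀ t, 0 ≤ t → b t ≤ a t
  β_nonneg : 0 ≤ β
  ν_nonneg : 0 ≤ ν
  κ_nonneg : 0 ≤ κ
  κ_lt_one : κ < 1
  A_nonneg : 0 ≤ A
  bounds : ∀ᵐ t, t₀ ≤ t → b t ≤ β * a t ∧ a t - b t ≤ ν * a t ∧ |p (g t) - p (h t)| ≤ κ ∧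
    p t - p (h t) ≤ 1 / Real.exp 1 + A

/-- `y` solves, on `[s, T]`, the equation obtained for `y = exp(lam p) x` from that of `x`, where
the exponential factors coming from the delays lie between `1` and `1 + ε`. -/
structure IsWeightedSolution (a b h g : ℝ → ℝ) (lam ε s T : ℝ) (y : ℝ → ℝ) : Prop where
  absCont : AbsolutelyContinuousOnInterval y s T
  equation : ∀ᵐ t, t ∈ Icc s T → ∃ G H, G ∈ Icc 1 (1 + ε) ∧ H ∈ Icc 1 (1 + ε) ∧
    HasDerivAt y (a t * (lam * y t) + b t * (G * y (g t)) - a t * (H * y (h t))) t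

theorem abs_mul_le_mul {c C x X : ℝ} (hc : |c| ≤ C) (hx : |x| ≤ X) : |c * x| ≤ C * X := by
  rw [abs_mul]
  exact mul_le_mul hc hx (abs_nonneg _) ((abs_nonneg _).trans hc)

/-- The slope of a weighted solution with respect to the clock is controlled by its size. The
equation gives `y' = -(a - b) y(h) + b (y(g) - y(h)) + ⋯`, in which the slope reappears on the
right with the factor `κ < 1`. -/
theorem ClockBounds.abs_sub_le {a b h g p : ℝ → ℝ} {r t₀ β ν κ A : ℝ}
    (hb : ClockBounds a b h g p r t₀ β ν κ A) {lam ε s T K Y : ℝ} {y : ℝ → ℝ} (hlam : 0 ≤ lam)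
    (hε : 0 ≤ ε) (hs : t₀ ≤ s) (hy : IsWeightedSolution a b h g lam ε s T y)
    (hK : ∀ t ∈ Icc (s - r) (s + r), |y t| ≤ K) (hY : ∀ t ∈ Icc (s - r) T, |y t| ≤ Y)
    {u v : ℝ} (hu : s ≤ u) (huv : u ≤ v) (hv : v ≤ T) :
    |y v - y u| ≤
      ((ν + lam + 2 * ε) * Y + (lam + 2 * (1 + ε)) * K) / (1 - κ) * (p v - p u) := by
  have hr := hb.r_nonneg
  have hp := hb.isClock
  have hs0 : 0 ≤ s := hb.t₀_nonneg.trans hs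
  have hK0 : 0 ≤ K := (abs_nonneg _).trans (hK s ⟨by linarith, by linarith⟩)
  have hY0 : 0 ≤ Y := (abs_nonneg _).trans (hY s ⟨by linarith, by linarith⟩)
  have hν := hb.ν_nonneg
  have hκ := hb.κ_nonneg
  set c := (ν + lam + 2 * ε) * Y + (lam + 2 * (1 + ε)) * K with hc
  set S : Set ℝ := {D | 0 ≤ D ∧ ∀ u v, s ≤ u → u ≤ v → v ≤ T →
    |y v - y u| ≤ D * (p v - p u)} with hS
  have hclosed : IsClosed S := by
    simp only [hS, ofPred_and, ofPred_forall]
    refine (isClosed_le continuous_const continuous_id).inter ?_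
    refine isClosed_iInter fun _ => isClosed_iInter fun _ => isClosed_iInter fun _ =>
      isClosed_iInter fun _ => isClosed_iInter fun _ => isClosed_le (by fun_prop) (by fun_prop)
  -- the crude bound, without cancellation between the two delayed terms
  have hcrude : ∀ t, 0 ≤ t → ∀ G ∈ Icc 1 (1 + ε), ∀ H ∈ Icc 1 (1 + ε), ∀ M,
      |y t| ≤ M → |y (g t)| ≤ M → |y (h t)| ≤ M →
      |a t * (lam * y t) + b t * (G * y (g t)) - a t * (H * y (h t))| ≤
        (lam + 2 * (1 + ε)) * M * a t := by
    intro t ht G hG H hH M h1 h2 h3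
    have ha := hp.nonneg t ht
    have hM : 0 ≤ M := (abs_nonneg _).trans h1
    have e1 := abs_mul_le_mul (abs_of_nonneg ha).le (abs_mul_le_mul (abs_of_nonneg hlam).le h1)
    have e2 := abs_mul_le_mul ((abs_of_nonneg (hb.b_nonneg t ht)).le.trans (hb.b_le_a t ht))
      (abs_mul_le_mul ((abs_of_nonneg (zero_le_one.trans hG.1)).le.trans hG.2) h2)
    have e3 := abs_mul_le_mul (abs_of_nonneg ha).le
      (abs_mul_le_mul ((abs_of_nonneg (zero_le_one.trans hH.1)).le.trans hH.2) h3)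
    rw [abs_le] at *
    constructor <;> linarith
  have h₀ : (lam + 2 * (1 + ε)) * Y ∈ S := by
    refine ⟨by positivity, fun u v hu huv hv => hp.abs_sub_le hs0 hy.absCont ?_ hu huv hv⟩
    filter_upwards [hy.equation] with t ht hmem
    obtain ⟨G, H, hG, hH, hd⟩ := ht hmem
    have ht0 := hs0.trans hmem.1
    have hg := hb.delay_g t ht0
    have hh := hb.delay_h t ht0
    exact ⟨_, hd, hcrude t ht0 G hG H hH Y (hY _ ⟨by linarith [hmem.1], hmem.2⟩)
      (hY _ ⟨by linarith [hmem.1], hg.2.trans hmem.2⟩)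
      (hY _ ⟨by linarith [hmem.1], hh.2.trans hmem.2⟩)⟩
  have hstep : ∀ D ∈ S, κ * D + c ∈ S := by
    rintro D ⟨hD0, hD⟩
    refine ⟨by positivity, fun u v hu huv hv => hp.abs_sub_le hs0 hy.absCont ?_ hu huv hv⟩
    filter_upwards [hy.equation, hb.bounds] with t ht hbd hmem
    obtain ⟨G, H, hG, hH, hd⟩ := ht hmem
    refine ⟨_, hd, ?_⟩
    have ht0 := hs0.trans hmem.1
    have ha := hp.nonneg t ht0
    have hg := hb.delay_g t ht0
    have hh := hb.delay_h t ht0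
    obtain ⟨-, hbν, hbκ, -⟩ := hbd (hs.trans hmem.1)
    rcases le_total t (s + r) with hts | hts
    · refine (hcrude t ht0 G hG H hH K (hK _ ⟨by linarith [hmem.1], hts⟩)
        (hK _ ⟨by linarith [hmem.1], hg.2.trans hts⟩)
        (hK _ ⟨by linarith [hmem.1], hh.2.trans hts⟩)).trans ?_
      gcongr
      rw [hc]
      have : 0 ≤ (ν + lam + 2 * ε) * Y := by positivity
      have := mul_nonneg hκ hD0
      linarith
    · have hslope : |y (g t) - y (h t)| ≤ D * κ := by
        refine le_trans ?_ (mul_le_mul_of_nonneg_left hbκ hD0)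
        rcases le_total (h t) (g t) with hle | hle
        · exact (hD _ _ (by linarith) hle (hg.2.trans hmem.2)).trans
            (mul_le_mul_of_nonneg_left (le_abs_self _) hD0)
        · rw [abs_sub_comm, abs_sub_comm (p (g t))]
          exact (hD _ _ (by linarith) hle (hh.2.trans hmem.2)).trans
            (mul_le_mul_of_nonneg_left (le_abs_self _) hD0)
      have y1 := hY t ⟨by linarith, hmem.2⟩
      have y2 := hY (g t) ⟨by linarith, hg.2.trans hmem.2⟩
      have y3 := hY (h t) ⟨by linarith, hh.2.trans hmem.2⟩
      have hba : |b t| ≤ a t := (abs_of_nonneg (hb.b_nonneg t ht0)).le.trans (hb.b_le_a t ht0)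
      have hG' : |G - 1| ≤ ε := by rw [abs_of_nonneg] <;> linarith [hG.1, hG.2]
      have hH' : |H - 1| ≤ ε := by rw [abs_of_nonneg] <;> linarith [hH.1, hH.2]
      have e1 := abs_mul_le_mul (abs_of_nonneg ha).le (abs_mul_le_mul (abs_of_nonneg hlam).le y1)
      have e2 := abs_mul_le_mul hba (abs_mul_le_mul hG' y2)
      have e3 := abs_mul_le_mul (abs_of_nonneg ha).le (abs_mul_le_mul hH' y3)
      have e4 := abs_mul_le_mul
        ((abs_of_nonneg (sub_nonneg.2 (hb.b_le_a t ht0))).le.trans hbν) y3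
      have e5 := abs_mul_le_mul hba hslope
      have e6 : 0 ≤ (lam + 2 * (1 + ε)) * K * a t := by positivity
      rw [abs_le] at *
      constructor <;> linarith
  exact (fixedPoint_mem_of_contraction hclosed hκ hb.κ_lt_one h₀ hstep).2 u v hu huv hv

/-- The contraction constant of the a priori estimate; at `lam = ε = 0` it is
`β + A ν / (1 - κ)`. -/
noncomputable def contractionRate (β ν κ A lam ε : ℝ) : ℝ :=
  lam + ε + β * (1 + ε) + A * ((ν + lam + 2 * ε) / (1 - κ))

/-- The a priori estimate. Let `h₀(t)` be the point between `h t` and `t` whose clock lag is cut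
off at `1/e`. Then `y' + a y(h₀) = a f`, where `f` consists of `(b/a) y(g)`, of `y(h₀) - y(h)`,
which is at most `A` times the slope of `y`, and of terms that are small with `lam` and `ε`; so `y`
is bounded by `contractionRate` times its own bound, up to the contribution of `K`. -/
theorem ClockBounds.abs_le_of_isWeightedSolution {a b h g p : ℝ → ℝ} {r t₀ β ν κ A : ℝ}
    (hb : ClockBounds a b h g p r t₀ β ν κ A) {lam ε s T K : ℝ} {y : ℝ → ℝ} (hlam : 0 ≤ lam)
    (hε : 0 ≤ ε) (hq : contractionRate β ν κ A lam ε < 1) (hs : t₀ ≤ s) (hsT : s + r ≤ T)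
    (hy : IsWeightedSolution a b h g lam ε s T y)
    (hK : ∀ t ∈ Icc (s - r) (s + r), |y t| ≤ K) {t : ℝ} (ht : t ∈ Icc (s - r) T) :
    |y t| ≤ (2 + A * ((lam + 2 * (1 + ε)) / (1 - κ))) * K /
      (1 - contractionRate β ν κ A lam ε) := by
  have hr := hb.r_nonneg
  have hp := hb.isClock
  have hs0 : 0 ≤ s := hb.t₀_nonneg.trans hs
  have hK0 : 0 ≤ K := (abs_nonneg _).trans (hK s ⟨by linarith, by linarith⟩)
  have hβ := hb.β_nonneg
  have hν := hb.ν_nonneg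
  have hA := hb.A_nonneg
  have hκ : 0 < 1 - κ := sub_pos.2 hb.κ_lt_one
  have hq0 : 0 ≤ contractionRate β ν κ A lam ε := by
    unfold contractionRate
    positivity
  set S : Set ℝ := {Y | 0 ≤ Y ∧ ∀ t, t ∈ Icc (s - r) T → |y t| ≤ Y} with hS
  have hclosed : IsClosed S := by
    simp only [hS, ofPred_and, ofPred_forall]
    refine (isClosed_le continuous_const continuous_id).inter ?_
    exact isClosed_iInter fun _ => isClosed_iInter fun _ => isClosed_le (by fun_prop) (by fun_prop)
  obtain ⟨C, hC⟩ := hy.absCont.exists_bound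
  rw [uIcc_of_le (by linarith)] at hC
  have h₀ : max C K ∈ S := by
    refine ⟨hK0.trans (le_max_right _ _), fun t ht => ?_⟩
    rcases le_total t s with h1 | h1
    · exact (hK t ⟨ht.1, by linarith⟩).trans (le_max_right _ _)
    · exact (hC t ⟨h1, ht.2⟩).trans (le_max_left _ _)
  have hstep : ∀ Y ∈ S, contractionRate β ν κ A lam ε * Y +
      (2 + A * ((lam + 2 * (1 + ε)) / (1 - κ))) * K ∈ S := by
    rintro Y ⟨hY0, hY⟩
    set D := ((ν + lam + 2 * ε) * Y + (lam + 2 * (1 + ε)) * K) / (1 - κ) with hD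
    have hD0 : 0 ≤ D := by positivity
    have hslope : ∀ u v, s ≤ u → u ≤ v → v ≤ T → |y v - y u| ≤ D * (p v - p u) :=
      fun u v hu huv hv => hb.abs_sub_le hlam hε hs hy hK hY hu huv hv
    have heq : contractionRate β ν κ A lam ε * Y +
        (2 + A * ((lam + 2 * (1 + ε)) / (1 - κ))) * K =
        ((lam + ε + β * (1 + ε)) * Y + A * D) + 2 * K := by
      rw [hD, contractionRate]
      field_simp
      ring
    refine ⟨by positivity, fun t ht => ?_⟩
    have hF : 0 ≤ (lam + ε + β * (1 + ε)) * Y + A * D := by positivity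
    rw [heq]
    rcases le_total t (s + r) with hts | hts
    · linarith [hK t ⟨ht.1, hts⟩]
    refine hp.abs_le_of_forced (s := s + r) (T := T) (by linarith) hF
      (absolutelyContinuousOnInterval_mono hy.absCont (by linarith) hsT le_rfl)
      (hK _ ⟨by linarith, le_rfl⟩) ?_ ⟨hts, ht.2⟩
    filter_upwards [hy.equation, hb.bounds] with t ht hbd hmem
    have hst : s ≤ t := by linarith [hmem.1]
    obtain ⟨G, H, hG, hH, hd⟩ := ht ⟨hst, hmem.2⟩
    have ht0 := hs0.trans hst
    have ha := hp.nonneg t ht0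
    have hg := hb.delay_g t ht0
    have hh := hb.delay_h t ht0
    obtain ⟨hbβ, -, -, hbA⟩ := hbd (hs.trans hst)
    obtain ⟨u, hu, hpu⟩ : ∃ u ∈ Icc (h t) t, p u = max (p (h t)) (p t - 1 / Real.exp 1) :=
      intermediate_value_Icc hh.2 hp.continuous.continuousOn
        ⟨le_max_left _ _, max_le (hp.mono hh.2) (by linarith [one_div_pos.2 (Real.exp_pos 1)])⟩
    refine ⟨_, u, hd, ?_, hu.2, by rw [hpu]; linarith [le_max_right (p (h t)) (p t - 1 / Real.exp 1)],
      fun hus => hK u ⟨by linarith [hu.1, hmem.1], hus.le⟩⟩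
    have hcut : |y u - y (h t)| ≤ D * A := by
      refine (hslope _ _ (by linarith [hmem.1]) hu.1 (hu.2.trans hmem.2)).trans
        (mul_le_mul_of_nonneg_left ?_ hD0)
      rw [hpu, sub_le_iff_le_add]
      exact max_le (by linarith) (by linarith)
    have y1 := hY t ⟨by linarith, hmem.2⟩
    have y2 := hY (g t) ⟨by linarith, hg.2.trans hmem.2⟩
    have y3 := hY (h t) ⟨by linarith, hh.2.trans hmem.2⟩
    have hH' : |H - 1| ≤ ε := by rw [abs_of_nonneg] <;> linarith [hH.1, hH.2]
    have e1 := abs_mul_le_mul (abs_of_nonneg ha).le (abs_mul_le_mul (abs_of_nonneg hlam).le y1)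
    have e2 := abs_mul_le_mul ((abs_of_nonneg (hb.b_nonneg t ht0)).le.trans hbβ)
      (abs_mul_le_mul ((abs_of_nonneg (zero_le_one.trans hG.1)).le.trans hG.2) y2)
    have e3 := abs_mul_le_mul (abs_of_nonneg ha).le (abs_mul_le_mul hH' y3)
    have e4 := abs_mul_le_mul (abs_of_nonneg ha).le hcut
    rw [abs_le] at *
    constructor <;> linarith
  exact (fixedPoint_mem_of_contraction hclosed hq0 hq h₀ hstep).2 t ht

/-! ### Exponential decay on the clock -/

theorem exists_contractionRate_lt_one {β ν κ A : ℝ} (hq : β + A * ν / (1 - κ) < 1) (B : ℝ) :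
    ∃ lam, 0 < lam ∧ contractionRate β ν κ A lam (Real.exp (lam * B) - 1) < 1 := by
  have hcont : Continuous fun lam => contractionRate β ν κ A lam (Real.exp (lam * B) - 1) := by
    unfold contractionRate
    fun_prop
  have h0 : contractionRate β ν κ A 0 (Real.exp (0 * B) - 1) < 1 := by
    simpa [contractionRate, mul_div_assoc] using hq
  have hev := (hcont.tendsto 0).eventually (gt_mem_nhds h0)
  obtain ⟨lam, h1, h2⟩ := ((hev.filter_mono (nhdsWithin_le_nhds (s := Ioi 0))).and
    self_mem_nhdsWithin).exists
  exact ⟨lam, h2, h1⟩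

theorem IsSolution.ae_hasDerivAt {a b h g φ x : ℝ → ℝ} {r s₀ : ℝ}
    (hx : IsSolution a b h g r s₀ φ x) :
    ∀ᵐ t, s₀ ≤ t → HasDerivAt x (b t * x (g t) - a t * x (h t)) t := by
  filter_upwards [(ae_restrict_iff' measurableSet_Ici).1 hx.equation] with t ht hmem
  obtain ⟨hd, heq⟩ := ht hmem
  exact hd.hasDerivAt.congr_deriv (by linarith)

theorem IsInitialFunction.abs_le_initialSup {φ : ℝ → ℝ} {r s₀ : ℝ}
    (hφ : IsInitialFunction r s₀ φ) {t : ℝ} (ht : t ∈ Icc (s₀ - r) s₀) :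
    |φ t| ≤ initialSup r s₀ φ := by
  obtain ⟨C, hC⟩ := hφ.2
  exact le_csSup ⟨C, by rintro _ ⟨u, hu, rfl⟩; exact hC u hu⟩ ⟨t, ht, rfl⟩

/-- Multiplying a solution by `exp(lam p)` gives a weighted solution. -/
theorem IsSolution.isWeightedSolution {a b h g p φ x : ℝ → ℝ} {r s₀ s T lam B : ℝ}
    (hp : IsClock a p) (hx : IsSolution a b h g r s₀ φ x) (hs₀ : 0 ≤ s₀) (hs : s₀ ≤ s)
    (hsT : s ≤ T) (hlam : 0 ≤ lam) (hh : ∀ t, 0 ≤ t → h t ≤ t ∧ p t - p (h t) ≤ B)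
    (hg : ∀ t, 0 ≤ t → g t ≤ t ∧ p t - p (g t) ≤ B) :
    IsWeightedSolution a b h g lam (Real.exp (lam * B) - 1) s T
      (fun t => Real.exp (lam * p t) * x t) := by
  refine ⟨(hp.absolutelyContinuous_exp lam s T).mul
    (absolutelyContinuousOnInterval_mono (hx.absCont T (hs.trans hsT)) hs hsT le_rfl), ?_⟩
  have hfac : ∀ t u, u ≤ t → p t - p u ≤ B →
      Real.exp (lam * (p t - p u)) ∈ Icc 1 (1 + (Real.exp (lam * B) - 1)) := by
    intro t u hut hpu
    have := hp.mono hut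
    refine ⟨by rw [Real.one_le_exp_iff]; exact mul_nonneg hlam (by linarith), ?_⟩
    rw [add_sub_cancel]
    gcongr
  filter_upwards [hx.ae_hasDerivAt, hp.hasDerivAt] with t ht hpt hmem
  have ht0 : 0 ≤ t := by linarith [hmem.1]
  refine ⟨Real.exp (lam * (p t - p (g t))), Real.exp (lam * (p t - p (h t))),
    hfac _ _ (hg t ht0).1 (hg t ht0).2, hfac _ _ (hh t ht0).1 (hh t ht0).2, ?_⟩
  have hcancel : ∀ u, Real.exp (lam * (p t - p u)) * (Real.exp (lam * p u) * x u) =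
      Real.exp (lam * p t) * x u := by
    intro u
    rw [← mul_assoc, ← Real.exp_add]
    ring_nf
  refine ((hasDerivAt_exp_clock (c := lam) (hpt ht0)).mul (ht (hs.trans hmem.1))).congr_deriv ?_
  rw [hcancel, hcancel]
  ring

/-- Under the smallness condition every solution decays exponentially with respect to the clock,
uniformly in the initial data. -/
theorem ClockBounds.exists_exp_decay {a b h g p : ℝ → ℝ} {r t₀ β ν κ A : ℝ}
    (hb : ClockBounds a b h g p r t₀ β ν κ A) (hq : β + A * ν / (1 - κ) < 1) :
    ∃ M lam, 0 < M ∧ 0 < lam ∧ ∀ s₀, 0 ≤ s₀ → ∀ φ x, IsInitialFunction r s₀ φ →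
      IsSolution a b h g r s₀ φ x → ∀ t, s₀ ≤ t →
        |x t| ≤ M * Real.exp (-lam * (p t - p s₀)) * initialSup r s₀ φ := by
  have hr := hb.r_nonneg
  have hp := hb.isClock
  have ht₀ := hb.t₀_nonneg
  obtain ⟨α, hα⟩ := hp.lipschitz
  have hlip : ∀ u v, u ≤ v → p v - p u ≤ α * (v - u) := fun u v huv => by
    have := hα.dist_le_mul v u
    rw [Real.dist_eq, Real.dist_eq, abs_of_nonneg (sub_nonneg.2 huv)] at this
    exact (le_abs_self _).trans this
  have hα0 : (0 : ℝ) ≤ α := α.2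
  obtain ⟨lam, hlam, hrate⟩ := exists_contractionRate_lt_one hq (α * r)
  set ε := Real.exp (lam * (α * r)) - 1 with hε
  have hε0 : 0 ≤ ε := by
    rw [hε, sub_nonneg, Real.one_le_exp_iff]
    positivity
  have hκ : 0 < 1 - κ := sub_pos.2 hb.κ_lt_one
  have hA := hb.A_nonneg
  set M₁ := (2 + A * ((lam + 2 * (1 + ε)) / (1 - κ))) / (1 - contractionRate β ν κ A lam ε)
    with hM₁
  have hM₁0 : 0 ≤ M₁ := div_nonneg (by positivity) (by linarith)
  set L := α * (t₀ + r) with hL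
  have hL0 : 0 ≤ L := by positivity
  refine ⟨(M₁ + 1) * Real.exp (lam * L) * (2 * Real.exp (4 * L)), lam, by positivity, hlam, ?_⟩
  intro s₀ hs₀ φ x hφ hx t ht
  set I := initialSup r s₀ φ with hI
  have hinit : ∀ u ∈ Icc (s₀ - r) s₀, |x u| ≤ I := fun u hu => by
    rw [hx.initial u hu]
    exact hφ.abs_le_initialSup hu
  have hI0 : 0 ≤ I := (abs_nonneg _).trans (hinit s₀ ⟨by linarith, le_rfl⟩)
  -- the estimates on the coefficients are available from `s` on
  set s := max s₀ t₀ with hs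
  have hs₀s : s₀ ≤ s := le_max_left _ _
  have hss : s ≤ s₀ + t₀ := max_le (by linarith) (by linarith)
  have hps : p (s + r) - p s₀ ≤ L := by
    refine (hlip s₀ (s + r) (by linarith)).trans ?_
    exact mul_le_mul_of_nonneg_left (by linarith) hα0
  have hhd : ∀ t, 0 ≤ t → h t ≤ t ∧ p t - p (h t) ≤ α * r := fun t ht =>
    ⟨(hb.delay_h t ht).2, (hlip _ _ (hb.delay_h t ht).2).trans
      (mul_le_mul_of_nonneg_left (by linarith [(hb.delay_h t ht).1]) hα0)⟩
  have hgd : ∀ t, 0 ≤ t → g t ≤ t ∧ p t - p (g t) ≤ α * r := fun t ht =>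
    ⟨(hb.delay_g t ht).2, (hlip _ _ (hb.delay_g t ht).2).trans
      (mul_le_mul_of_nonneg_left (by linarith [(hb.delay_g t ht).1]) hα0)⟩
  set K := 2 * Real.exp (4 * L) * I with hK
  have hK0 : 0 ≤ K := by positivity
  have hstart : ∀ u ∈ Icc (s₀ - r) (s + r), |x u| ≤ K := by
    intro u hu
    rcases le_total u s₀ with hus | hus
    · refine (hinit u ⟨hu.1, hus⟩).trans ?_
      have : 1 ≤ Real.exp (4 * L) := Real.one_le_exp_iff.2 (by positivity)
      rw [hK]
      nlinarith
    · refine (hp.abs_le_exp hs₀ hb.delay_h hb.delay_g (hx.absCont (s + r) (by linarith)) hr hinit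
        ?_ ⟨hus, hu.2⟩).trans ?_
      · filter_upwards [hx.ae_hasDerivAt] with v hv hmem
        refine ⟨_, hv hmem.1, ?_⟩
        have hv0 := hs₀.trans hmem.1
        have e1 := abs_mul_le_mul ((abs_of_nonneg (hb.b_nonneg v hv0)).le.trans (hb.b_le_a v hv0))
          (le_refl |x (g v)|)
        have e2 := abs_mul_le_mul (abs_of_nonneg (hp.nonneg v hv0)).le (le_refl |x (h v)|)
        refine (abs_sub _ _).trans ?_
        linarith
      · have : p u - p s₀ ≤ L := by linarith [hp.mono hu.2]
        rw [hK]
        have h4 : Real.exp (4 * (p u - p s₀)) ≤ Real.exp (4 * L) := by gcongr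
        nlinarith
  set Ky := Real.exp (lam * p (s + r)) * K with hKy
  have hKy0 : 0 ≤ Ky := by positivity
  have hystart : ∀ u ∈ Icc (s₀ - r) (s + r), |Real.exp (lam * p u) * x u| ≤ Ky := by
    intro u hu
    refine abs_mul_le_mul ?_ (hstart u hu)
    rw [abs_of_pos (Real.exp_pos _)]
    gcongr
    exact hp.mono hu.2
  have hyt : |Real.exp (lam * p t) * x t| ≤ (M₁ + 1) * Ky := by
    rcases le_total t (s + r) with hts | hts
    · have := hystart t ⟨by linarith, hts⟩
      nlinarith
    · have := hb.abs_le_of_isWeightedSolution hlam.le hε0 hrate (le_max_right s₀ t₀) hts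
        (hx.isWeightedSolution hp hs₀ hs₀s (by linarith) hlam.le hhd hgd)
        (fun u hu => hystart u ⟨by linarith [hu.1], hu.2⟩) (t := t) ⟨by linarith, le_rfl⟩
      rw [mul_div_right_comm, ← hM₁] at this
      linarith
  rw [abs_mul, abs_of_pos (Real.exp_pos _)] at hyt
  have hKy' : Ky ≤ Real.exp (lam * p s₀) * Real.exp (lam * L) * K := by
    rw [hKy, ← Real.exp_add]
    gcongr
    nlinarith
  have hexp : Real.exp (-lam * (p t - p s₀)) * Real.exp (lam * p t) = Real.exp (lam * p s₀) := by
    rw [← Real.exp_add]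
    ring_nf
  refine le_of_mul_le_mul_left (hyt.trans ?_) (Real.exp_pos (lam * p t))
  calc (M₁ + 1) * Ky ≤ (M₁ + 1) * (Real.exp (lam * p s₀) * Real.exp (lam * L) * K) := by gcongr
    _ = _ := by
      rw [← hexp, hK]
      ring

/-! ### The clock and the bounds provided by the data -/

/-- The clock of the equation: the primitive of `a`, extended by zero to the left of `0`. -/
noncomputable def clock (a : ℝ → ℝ) (t : ℝ) : ℝ := coeffIntegral a 0 t

theorem locallyIntegrable_indicator {a : ℝ → ℝ} (ha : MemLp a ⊤ (volume.restrict (Ici (0 : ℝ)))) :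
    LocallyIntegrable ((Ici (0 : ℝ)).indicator a) :=
  ((memLp_indicator_iff_restrict measurableSet_Ici).2 ha).locallyIntegrable le_top

theorem coeffIntegral_eq_clock_sub {a : ℝ → ℝ} (ha : MemLp a ⊤ (volume.restrict (Ici (0 : ℝ))))
    (u v : ℝ) : coeffIntegral a u v = clock a v - clock a u := by
  have hint : ∀ u v : ℝ, IntervalIntegrable ((Ici (0 : ℝ)).indicator a) volume u v := fun u v =>
    intervalIntegrable_iff.mpr <|
      ((locallyIntegrable_indicator ha).integrableOn_isCompact isCompact_uIcc).mono_set
        uIoc_subset_uIcc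
  exact (intervalIntegral.integral_interval_sub_left (hint _ _) (hint _ _)).symm

theorem coeffIntegral_eq_integral (a : ℝ → ℝ) {u v : ℝ} (hu : 0 ≤ u) (hv : 0 ≤ v) :
    coeffIntegral a u v = ∫ s in u..v, a s := by
  refine intervalIntegral.integral_congr fun t ht => indicator_of_mem ?_ _
  exact (le_min hu hv).trans ht.1

theorem isClock_clock {a : ℝ → ℝ} (ha : MemLp a ⊤ (volume.restrict (Ici (0 : ℝ))))
    (hnonneg : ∀ t, 0 ≤ t → 0 ≤ a t) : IsClock a (clock a) where
  mono u v huv := by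
    rw [← sub_nonneg, ← coeffIntegral_eq_clock_sub ha]
    exact intervalIntegral.integral_nonneg huv fun t _ => indicator_nonneg (fun t ht => hnonneg t ht) t
  lipschitz := by
    have hmem := (memLp_indicator_iff_restrict measurableSet_Ici).2 ha
    have htop := hmem.eLpNorm_lt_top
    rw [eLpNorm_exponent_top] at htop
    refine ⟨(eLpNormEssSup ((Ici (0 : ℝ)).indicator a) volume).toNNReal,
      LipschitzWith.of_dist_le_mul fun v u => ?_⟩
    rw [Real.dist_eq, Real.dist_eq, ← coeffIntegral_eq_clock_sub ha]
    refine intervalIntegral.norm_integral_le_of_norm_le_const_ae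
      (f := (Ici (0 : ℝ)).indicator a) ?_
    filter_upwards [enorm_ae_le_eLpNormEssSup ((Ici (0 : ℝ)).indicator a) volume] with t ht _
    exact ENNReal.toReal_mono htop.ne ht
  hasDerivAt := by
    filter_upwards [LocallyIntegrable.ae_hasDerivAt_integral (locallyIntegrable_indicator ha)] with t ht ht0
    have := ht 0
    rwa [indicator_of_mem (mem_Ici.2 ht0)] at this
  nonneg := hnonneg

theorem ae_abs_le_normFrom {f : ℝ → ℝ} {t₀ C : ℝ} (hf : ∀ t, t₀ ≤ t → |f t| ≤ C) :
    ∀ᵐ t, t₀ ≤ t → |f t| ≤ normFrom t₀ f := by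
  refine (ae_restrict_iff' measurableSet_Ici).1 (ae_le_essSup (isBoundedUnder_of_eventually_le
    (a := C) ?_))
  filter_upwards [ae_restrict_mem measurableSet_Ici] with t ht using hf t ht

theorem normFrom_nonneg {f : ℝ → ℝ} {t₀ C : ℝ} (hf : ∀ t, t₀ ≤ t → |f t| ≤ C) :
    0 ≤ normFrom t₀ f := by
  have h := (ae_restrict_iff' measurableSet_Ici).2 (ae_abs_le_normFrom hf)
  have : NeBot (ae (volume.restrict (Ici t₀))) := by
    rw [ae_neBot, Ne, Measure.restrict_eq_zero]
    simp
  obtain ⟨t, ht⟩ := h.exists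
  exact (abs_nonneg _).trans ht

theorem Data.clockBounds {a b h g : ℝ → ℝ} {τ δ : ℝ} (hdata : Data a b h g τ δ) {t₀ : ℝ}
    (ht₀ : 0 ≤ t₀)
    (hhg : normFrom t₀ (fun t => coeffIntegral a (h t) (g t)) < 1) :
    ClockBounds a b h g (clock a) (max δ τ) t₀ (normFrom t₀ fun t => b t / a t)
      (normFrom t₀ fun t => 1 - b t / a t) (normFrom t₀ fun t => coeffIntegral a (h t) (g t))
      (normFrom t₀ fun t => max (coeffIntegral a (h t) t - 1 / Real.exp 1) 0) := by
  have ha : ∀ t, 0 ≤ t → 0 ≤ a t := fun t ht => (hdata.b_nonneg t ht).trans (hdata.b_le_a t ht)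
  have hp := isClock_clock hdata.memLp_a ha
  have hh : ∀ t, 0 ≤ t → t - max δ τ ≤ h t ∧ h t ≤ t := fun t ht => by
    constructor <;> linarith [(hdata.h_delay t ht).1, (hdata.h_delay t ht).2, le_max_right δ τ]
  have hg : ∀ t, 0 ≤ t → t - max δ τ ≤ g t ∧ g t ≤ t := fun t ht => by
    constructor <;> linarith [(hdata.g_delay t ht).1, (hdata.g_delay t ht).2, le_max_left δ τ]
  have hr : 0 ≤ max δ τ := by linarith [(hh 0 le_rfl).1, (hh 0 le_rfl).2]
  obtain ⟨α, hα⟩ := hp.lipschitz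
  have hlip : ∀ u v, |u - v| ≤ max δ τ → |clock a u - clock a v| ≤ α * max δ τ := fun u v huv =>
    (hα.dist_le_mul u v).trans (mul_le_mul_of_nonneg_left huv α.2)
  have hquot : ∀ t, t₀ ≤ t → 0 ≤ b t / a t ∧ b t / a t ≤ 1 := fun t ht =>
    ⟨div_nonneg (hdata.b_nonneg t (ht₀.trans ht)) (ha t (ht₀.trans ht)),
      div_le_one_of_le₀ (hdata.b_le_a t (ht₀.trans ht)) (ha t (ht₀.trans ht))⟩
  have bβ : ∀ t, t₀ ≤ t → |b t / a t| ≤ 1 := fun t ht => by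
    rw [abs_le]
    constructor <;> linarith [(hquot t ht).1, (hquot t ht).2]
  have bν : ∀ t, t₀ ≤ t → |1 - b t / a t| ≤ 1 := fun t ht => by
    rw [abs_le]
    constructor <;> linarith [(hquot t ht).1, (hquot t ht).2]
  have bκ : ∀ t, t₀ ≤ t → |coeffIntegral a (h t) (g t)| ≤ α * max δ τ := fun t ht => by
    rw [coeffIntegral_eq_clock_sub hdata.memLp_a]
    refine hlip _ _ (abs_le.2 ?_)
    constructor <;> linarith [(hh t (ht₀.trans ht)).1, (hh t (ht₀.trans ht)).2,
      (hg t (ht₀.trans ht)).1, (hg t (ht₀.trans ht)).2]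
  have bA : ∀ t, t₀ ≤ t →
      |max (coeffIntegral a (h t) t - 1 / Real.exp 1) 0| ≤ α * max δ τ := fun t ht => by
    rw [abs_of_nonneg (le_max_right _ _), coeffIntegral_eq_clock_sub hdata.memLp_a]
    have := hlip t (h t) (abs_le.2 ⟨by linarith [(hh t (ht₀.trans ht)).2],
      by linarith [(hh t (ht₀.trans ht)).1]⟩)
    refine max_le ?_ ((abs_nonneg _).trans this)
    linarith [le_abs_self (clock a t - clock a (h t)), one_div_pos.2 (Real.exp_pos 1)]
  refine ⟨hp, hr, ht₀, hh, hg, hdata.b_nonneg, hdata.b_le_a, normFrom_nonneg bβ,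
    normFrom_nonneg bν, normFrom_nonneg bκ, hhg, normFrom_nonneg bA, ?_⟩
  filter_upwards [ae_abs_le_normFrom bβ, ae_abs_le_normFrom bν, ae_abs_le_normFrom bκ,
    ae_abs_le_normFrom bA] with t h1 h2 h3 h4 ht
  have hat := ha t (ht₀.trans ht)
  -- where `a` vanishes, so does `b`
  have hba : b t = b t / a t * a t := by
    rcases hat.eq_or_lt with h0 | h0
    · rw [← h0, mul_zero]
      exact le_antisymm ((hdata.b_le_a t (ht₀.trans ht)).trans h0.ge)
        (hdata.b_nonneg t (ht₀.trans ht))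
    · rw [div_mul_cancel₀ _ h0.ne']
  refine ⟨?_, ?_, ?_, ?_⟩
  · nth_rewrite 1 [hba]
    exact mul_le_mul_of_nonneg_right ((le_abs_self _).trans (h1 ht)) hat
  · nth_rewrite 1 [hba]
    have := mul_le_mul_of_nonneg_right ((le_abs_self _).trans (h2 ht)) hat
    linarith
  · rw [← coeffIntegral_eq_clock_sub hdata.memLp_a]
    exact h3 ht
  · rw [← coeffIntegral_eq_clock_sub hdata.memLp_a]
    linarith [(le_max_left (coeffIntegral a (h t) t - 1 / Real.exp 1) 0).trans
      ((le_abs_self _).trans (h4 ht))]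

/-! ### From clock time to real time -/

theorem asymptoticallyStable_of_exp_decay {a b h g p : ℝ → ℝ} {r M lam : ℝ} (hM : 0 < M)
    (hlam : 0 < lam) (hp : Monotone p) (htop : Tendsto p atTop atTop)
    (hdecay : ∀ s₀, 0 ≤ s₀ → ∀ φ x, IsInitialFunction r s₀ φ → IsSolution a b h g r s₀ φ x →
      ∀ t, s₀ ≤ t → |x t| ≤ M * Real.exp (-lam * (p t - p s₀)) * initialSup r s₀ φ) :
    AsymptoticallyStable a b h g r := by
  intro s₀ hs₀
  refine ⟨fun ε hε => ⟨ε / M, by positivity, fun φ x hφ hx hsup t ht => ?_⟩,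
    fun φ x hφ hx => ?_⟩
  · have h1 : Real.exp (-lam * (p t - p s₀)) ≤ 1 := by
      rw [Real.exp_le_one_iff]
      nlinarith [hp ht]
    have hI : 0 ≤ initialSup r s₀ φ := by
      apply Real.sSup_nonneg
      rintro _ ⟨u, _, rfl⟩
      exact abs_nonneg _
    calc |x t| ≤ M * Real.exp (-lam * (p t - p s₀)) * initialSup r s₀ φ :=
          hdecay s₀ hs₀ φ x hφ hx t ht
      _ ≤ M * 1 * initialSup r s₀ φ := by gcongr
      _ < M * 1 * (ε / M) := by gcongr
      _ = ε := by field_simp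
  · refine squeeze_zero_norm' ((eventually_ge_atTop s₀).mono (hdecay s₀ hs₀ φ x hφ hx)) ?_
    have h1 : Tendsto (fun t => -lam * (p t - p s₀)) atTop atBot :=
      (tendsto_atTop_add_const_right _ (-p s₀) htop).const_mul_atTop_of_neg (neg_lt_zero.2 hlam)
    simpa using ((Real.tendsto_exp_atBot.comp h1).const_mul M).mul_const (initialSup r s₀ φ)

/-- A clock that eventually advances by at least `c` in every time span `T` runs at least
linearly. -/
theorem linear_lower_bound_of_increments {p : ℝ → ℝ} (hp : Monotone p) {T c t₁ : ℝ} (hT : 0 < T)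
    (hc : 0 < c) (ht₁ : 0 ≤ t₁) (hinc : ∀ t, t₁ ≤ t → c ≤ p (t + T) - p t) {s t : ℝ} (hs : 0 ≤ s)
    (hst : s ≤ t) : c / T * (t - s) - c * (t₁ / T + 1) ≤ p t - p s := by
  have hsteps : ∀ m, t₁ ≤ m → ∀ n : ℕ, n * c ≤ p (m + n * T) - p m := by
    intro m hm n
    induction n with
    | zero => simp
    | succ n ih =>
      have hnT : 0 ≤ n * T := by positivity
      have := hinc (m + n * T) (by linarith)
      push_cast
      rw [show m + (n + 1) * T = m + n * T + T by ring]
      linarith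
  have heq : c / T * (t - s) - c * (t₁ / T + 1) = c * ((t - s - t₁) / T - 1) := by
    field_simp
    ring
  rw [heq]
  rcases le_total t (max s t₁) with htm | htm
  · have h1 : (t - s - t₁) / T ≤ 0 := by
      refine div_nonpos_of_nonpos_of_nonneg ?_ hT.le
      rcases le_max_iff.1 htm with h | h <;> linarith
    nlinarith [hp hst]
  · set m := max s t₁ with hm
    have hms : m ≤ s + t₁ := max_le (by linarith) (by linarith)
    set n := ⌊(t - m) / T⌋₊ with hn
    have hn1 : n * T ≤ t - m := by
      rw [← le_div_iff₀ hT]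
      exact Nat.floor_le (div_nonneg (by linarith) hT.le)
    have hn2 : (t - m) / T < n + 1 := Nat.lt_floor_add_one _
    have h1 := hsteps m (le_max_right _ _) n
    have h2 : p (m + n * T) ≤ p t := hp (by linarith)
    have h3 : p s ≤ p m := hp (le_max_left _ _)
    have h4 : (t - s - t₁) / T ≤ (t - m) / T :=
      div_le_div_of_nonneg_right (by linarith) hT.le
    nlinarith

theorem uniformlyExponentiallyStable_of_exp_decay {a b h g p : ℝ → ℝ} {r M lam k C : ℝ}
    (hM : 0 < M) (hlam : 0 < lam) (hk : 0 < k)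
    (hlin : ∀ s t, 0 ≤ s → s ≤ t → k * (t - s) - C ≤ p t - p s)
    (hdecay : ∀ s₀, 0 ≤ s₀ → ∀ φ x, IsInitialFunction r s₀ φ → IsSolution a b h g r s₀ φ x →
      ∀ t, s₀ ≤ t → |x t| ≤ M * Real.exp (-lam * (p t - p s₀)) * initialSup r s₀ φ) :
    UniformlyExponentiallyStable a b h g r := by
  refine ⟨M * Real.exp (lam * C), lam * k, by positivity, by positivity, ?_⟩
  intro s₀ hs₀ φ x hφ hx t ht
  have hI : 0 ≤ initialSup r s₀ φ := by
    apply Real.sSup_nonneg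
    rintro _ ⟨u, _, rfl⟩
    exact abs_nonneg _
  refine (hdecay s₀ hs₀ φ x hφ hx t ht).trans ?_
  rw [mul_assoc M (Real.exp (lam * C)), ← Real.exp_add]
  gcongr
  nlinarith [mul_le_mul_of_nonneg_left (hlin s₀ t hs₀ ht) hlam.le]

end DelayEq

theorem theorem3 (a b h g : ℝ → ℝ) (τ δ : ℝ) (hdata : DelayEq.Data a b h g τ δ)
    (ha_ne : ∀ᵐ t ∂(volume.restrict (Ici (0 : ℝ))), a t ≠ 0)
    (ha_int : Tendsto (fun t : ℝ => ∫ s in (0 : ℝ)..t, a s) atTop atTop)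
    (t₀ : ℝ) (ht₀ : 0 ≤ t₀)
    (hba : DelayEq.esssupFrom t₀ (fun t => b t / a t) < 1)
    (hhg : DelayEq.esssupFrom t₀ (fun t => |DelayEq.coeffIntegral a (h t) (g t)|) < 1)
    (hmain : DelayEq.normFrom t₀
        (fun t => max (DelayEq.coeffIntegral a (h t) t - 1 / Real.exp 1) 0) <
      (1 - DelayEq.normFrom t₀ (fun t => b t / a t)) /
        DelayEq.normFrom t₀ (fun t => 1 - b t / a t) *
        (1 - DelayEq.normFrom t₀ (fun t => DelayEq.coeffIntegral a (h t) (g t)))) :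
    DelayEq.AsymptoticallyStable a b h g (max δ τ) ∧
    ((∃ T : ℝ, 0 < T ∧ 0 < liminf (fun t : ℝ => ∫ s in t..(t + T), a s) atTop) →
      DelayEq.UniformlyExponentiallyStable a b h g (max δ τ)) := by
  have hb := hdata.clockBounds ht₀ hhg
  have hrate : DelayEq.normFrom t₀ (fun t => b t / a t) +
      DelayEq.normFrom t₀ (fun t => max (DelayEq.coeffIntegral a (h t) t - 1 / Real.exp 1) 0) *
      DelayEq.normFrom t₀ (fun t => 1 - b t / a t) /
      (1 - DelayEq.normFrom t₀ (fun t => DelayEq.coeffIntegral a (h t) (g t))) < 1 := by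
    have hκ := sub_pos.2 hb.κ_lt_one
    -- a vanishing denominator in `hmain` would make its right-hand side zero
    have hν : 0 < DelayEq.normFrom t₀ (fun t => 1 - b t / a t) := by
      refine hb.ν_nonneg.lt_of_ne fun h0 => ?_
      rw [← h0, div_zero, zero_mul] at hmain
      exact hmain.not_ge hb.A_nonneg
    rw [div_mul_eq_mul_div, lt_div_iff₀ hν] at hmain
    rw [← lt_sub_iff_add_lt', div_lt_iff₀ hκ]
    exact hmain
  obtain ⟨M, lam, hM, hlam, hdecay⟩ := hb.exists_exp_decay hrate
  have hmono := hb.isClock.mono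
  refine ⟨DelayEq.asymptoticallyStable_of_exp_decay hM hlam hmono ?_ hdecay, ?_⟩
  · refine ha_int.congr' ?_
    filter_upwards [eventually_ge_atTop 0] with t ht
    exact (DelayEq.coeffIntegral_eq_integral a le_rfl ht).symm
  rintro ⟨T, hT, hlim⟩
  obtain ⟨c, hc, hc0⟩ : ∃ c, (∀ᶠ t : ℝ in atTop, c ≤ ∫ s in t..(t + T), a s) ∧ 0 < c := by
    by_contra! hcon
    rw [liminf_eq] at hlim
    exact hlim.not_ge (Real.sSup_nonpos fun c hc => hcon c hc)
  obtain ⟨t₁, ht₁⟩ := eventually_atTop.1 hc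
  refine DelayEq.uniformlyExponentiallyStable_of_exp_decay hM hlam (div_pos hc0 hT)
    (fun s t hs hst => DelayEq.linear_lower_bound_of_increments hmono hT hc0
      (le_max_right t₁ 0) (fun t ht => ?_) hs hst) hdecay
  have ht0 : 0 ≤ t := (le_max_right _ _).trans ht
  rw [← DelayEq.coeffIntegral_eq_clock_sub hdata.memLp_a,
    DelayEq.coeffIntegral_eq_integral a ht0 (by linarith)]
  exact ht₁ t ((le_max_left _ _).trans ht)
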